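/- Let $a(x)=\frac{2-3x}{1-x}$ and $b(x)=\frac{1}{1-x}$ for $x<1$, and consider the system $$x'=y-x,\qquad y'=a(x)y-b(x)y^2 .$$ Let $z=\tfrac12$, so that $a(z)=zb(z)$ and $(z,z)$ is a stationary point. Let $w\in(0,1)$ be the solution of $(a(0)+1)\,w\,b(w)=a(w)$, that is, $w=\tfrac13$. Let $A,B$ be the primitives of $a,b$ on $(-\infty,1)$ with $A(z)=B(z)=0$, and put $H=zB-A$. Then: 1. $2H(x)=-6x-3\log(1-x)+6z+3\log(1-z)$ for $z\le x<1$, and there is exactly one $X\in[z,1)$ with $$2H(X)=\log z-2z+2(a(0)+1)w-\log\big((a(0)+1)w\big).$$ 2. This $X$ satisfies $$2X=2+W\!\left(-2e^{-\frac43-\frac23\log 2}\right)=2+W\!\left(-2^{1/3}e^{-4/3}\right),$$ where $W$ is the principal branch of the Lambert function, i.e. the inverse of $s\mapsto se^{s}$ on $[-1,\infty)$. Moreover $X<0.7$. 3. Every heteroclinic trajectory joining $(0,0)$ with $(\tfrac12,\tfrac12)$ satisfies $x(t)\le X$ for all $t\in\mathbb R$. Here a heteroclinic trajectory is a solution $(x,y)$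 on $\mathbb R$ with $x<1$, with $(x,y)(t)\to(0,0)$ as $t\to-\infty$ and $(x,y)(t)\to(\tfrac12,\tfrac12)$ as $t\to\infty$. 4. Let $G,c,R>0$, let $\varrho\ge 0$ be continuous on $(0,R]$ with $r^2\varrho(r)\to0$ as $r\to0^+$ (for instance, $\varrho$ bounded near $0$), and let $m(r)=4\pi\int_0^r s^2\varrho(s)\,ds$ and $p=c^2\varrho$. Suppose that $2Gm(r)<rc^2$ on $(0,R)$ and that the Tolman–Oppenheimer–Volkoff equation $$\frac{dp}{dr}=-\frac{G(\varrho c^2+p)(mc^2+4\pi r^3p)}{rc^2(rc^2-2Gm)}$$ holds on $(0,R)$. Then the mass $M=m(R)$ satisfies $\dfrac{2GM}{Rc^2}<0.7$. -/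

import Mathlib

open Filter Topology Set

noncomputable section

namespace TOV

/-- The principal real branch of the Lambert function: the inverse of `w ↦ w * exp w` restricted
to `[-1, ∞)` (meaningful for arguments `≥ -exp (-1)`). -/
def lambertW (s : ℝ) : ℝ :=
  Function.invFunOn (fun w : ℝ => w * Real.exp w) (Ici (-1)) s

/-- `(x, y)` is a heteroclinic trajectory of `x' = y - x`, `y' = a(x) y - b(x) y²`, where `a, b`
are considered on the domain `D`, joining `(0, 0)` (as `t → -∞`) with `(z, z)` (as `t → ∞`). -/
structure IsHeteroclinic (a b : ℝ → ℝ) (D : Set ℝ) (z : ℝ) (x y : ℝ → ℝ) : Prop where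
  mem_domain : ∀ t, x t ∈ D
  deriv_x : ∀ t, HasDerivAt x (y t - x t) t
  deriv_y : ∀ t, HasDerivAt y (a (x t) * y t - b (x t) * y t ^ 2) t
  tendsto_atBot : Tendsto (fun t => (x t, y t)) atBot (𝓝 (0, 0))
  tendsto_atTop : Tendsto (fun t => (x t, y t)) atTop (𝓝 (z, z))

/-- The function `H = z B - A`, where `A, B` are the primitives of `a, b` vanishing at `z`. -/
def lyapH (a b : ℝ → ℝ) (z x : ℝ) : ℝ :=
  z * (∫ t in z..x, b t) - ∫ t in z..x, a t

/-- The coefficient `a` of the relativistic system (used for `x < 1`). -/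
def relA (x : ℝ) : ℝ := (2 - 3 * x) / (1 - x)

/-- The coefficient `b` of the relativistic system (used for `x < 1`). -/
def relB (x : ℝ) : ℝ := 1 / (1 - x)

/-- The mass inside radius `r` for the radial density `ϱ`. -/
def mass (ϱ : ℝ → ℝ) (r : ℝ) : ℝ :=
  4 * Real.pi * ∫ s in (0 : ℝ)..r, s ^ 2 * ϱ s

/-- Density `ϱ` and pressure `p` of a static configuration of radius `R`, with equation of state
`p = c² ϱ`, obeying the Tolman–Oppenheimer–Volkoff equation. The condition at the centre holds for
every density bounded near `r = 0`; it says that `8 π G r² ϱ(r) / c²` (and hence also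
`2 G m(r) / (r c²)`) tends to `0` as `r → 0`. -/
structure IsTOVSolution (G c R : ℝ) (ϱ p : ℝ → ℝ) : Prop where
  density_nonneg : ∀ r ∈ Ioc 0 R, 0 ≤ ϱ r
  continuousOn : ContinuousOn ϱ (Ioc 0 R)
  centre : Tendsto (fun r => r ^ 2 * ϱ r) (𝓝[>] 0) (𝓝 0)
  state : ∀ r ∈ Ioc 0 R, p r = c ^ 2 * ϱ r
  no_horizon : ∀ r ∈ Ioo 0 R, 2 * G * mass ϱ r < r * c ^ 2
  tov : ∀ r ∈ Ioo 0 R, HasDerivAt p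
    (-(G * (ϱ r * c ^ 2 + p r) * (mass ϱ r * c ^ 2 + 4 * Real.pi * r ^ 3 * p r)) /
      (r * c ^ 2 * (r * c ^ 2 - 2 * G * mass ϱ r))) r

end TOV

end

namespace TOV

/-! ### The function `H`, the number `X` and the Lambert function -/

/-! Up to a constant, `2 * y - log y + potential x` is a Lyapunov function: along trajectories with
`y > 0` its derivative is minus a sum of squares over `1 - x` (`lyapunov_le`). If `x t > 1/2`, go
back to the last time `s` with `x s = 1/2`. There `x' ≥ 0`, so `y s ≥ 1/2`, while a barrier argument
gives `y ≤ 1` (`y_le_one`). Hence `2y - log y ≤ 2` at `s`, and it is at least its minimum `1 + log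
2` at `t`. So `potential (x t) ≤ potential (1/2) + 1 - log 2 = potential X`, and monotonicity of
`potential` on `[1/2, 1)` gives `x t ≤ X` (`x_le`).

Only the past of `t` is used. The estimate is therefore stated for trajectories leaving the origin
on a half-line, which covers heteroclinic orbits as well as TOV configurations written in `t = log
r`, with `x = 2Gm/(rc²)` and `y = 8πGr²ϱ/c²`. -/

/-- An explicit form of `2 * H`, up to an additive constant. -/
noncomputable def potential (x : ℝ) : ℝ := -6 * x - 3 * Real.log (1 - x)

theorem hasDerivAt_log_one_sub {x : ℝ} (hx : x < 1) :
    HasDerivAt (fun x : ℝ => Real.log (1 - x)) (-1 / (1 - x)) x := by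
  have h := ((hasDerivAt_id x).const_sub 1).log (by simp; linarith)
  simpa using h

theorem hasDerivAt_potential {x : ℝ} (hx : x < 1) :
    HasDerivAt potential (-6 + 3 / (1 - x)) x := by
  have h := ((hasDerivAt_id x).const_mul (-6)).sub ((hasDerivAt_log_one_sub hx).const_mul 3)
  exact h.congr_deriv (by ring)

theorem continuousOn_potential : ContinuousOn potential (Iio 1) :=
  fun _ hx => (hasDerivAt_potential hx).continuousAt.continuousWithinAt

theorem strictMonoOn_potential : StrictMonoOn potential (Ico (1 / 2) 1) := by
  refine strictMonoOn_of_deriv_pos (convex_Ico _ _)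
    (continuousOn_potential.mono fun x hx => hx.2) fun x hx => ?_
  rw [interior_Ico] at hx
  rw [(hasDerivAt_potential hx.2).deriv]
  have h1 : 0 < 1 - x := by linarith [hx.2]
  have h2 : 6 < 3 / (1 - x) := by
    rw [lt_div_iff₀ h1]
    linarith [hx.1]
  linarith

theorem two_mul_lyapH {x : ℝ} (hx : x < 1) :
    2 * lyapH relA relB (1 / 2) x = potential x - potential (1 / 2) := by
  have hlt : ∀ t ∈ uIcc (1 / 2) x, t < 1 := fun t ht =>
    ht.2.trans_lt (max_lt (by norm_num) hx)
  have hne : ∀ t ∈ uIcc (1 / 2) x, (1 : ℝ) - t ≠ 0 := fun t ht => by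
    linarith [hlt t ht]
  have hB : ∫ t in (1 / 2)..x, relB t = -Real.log (1 - x) - -Real.log (1 - 1 / 2) := by
    refine intervalIntegral.integral_eq_sub_of_hasDerivAt
      (f := fun t => -Real.log (1 - t)) (fun t ht => ?_) ?_
    · refine (hasDerivAt_log_one_sub (hlt t ht)).neg.congr_deriv ?_
      unfold relB
      ring
    · refine ContinuousOn.intervalIntegrable ?_
      unfold relB
      exact continuousOn_const.div (by fun_prop) hne
  have hA : ∫ t in (1 / 2)..x, relA t =
      (3 * x + Real.log (1 - x)) - (3 * (1 / 2) + Real.log (1 - 1 / 2)) := by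
    refine intervalIntegral.integral_eq_sub_of_hasDerivAt
      (f := fun t => 3 * t + Real.log (1 - t)) (fun t ht => ?_) ?_
    · refine (((hasDerivAt_id t).const_mul 3).add
        (hasDerivAt_log_one_sub (hlt t ht))).congr_deriv ?_
      unfold relA
      have := hne t ht
      field_simp
      ring
    · refine ContinuousOn.intervalIntegrable ?_
      unfold relA
      exact ContinuousOn.div (by fun_prop) (by fun_prop) hne
  unfold lyapH potential
  rw [hA, hB]
  ring

theorem log_one_half : Real.log (1 / 2) = -Real.log 2 := by
  rw [one_div, Real.log_inv]

theorem potential_one_half : potential (1 / 2) = -3 + 3 * Real.log 2 := by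
  unfold potential
  rw [show (1 : ℝ) - 1 / 2 = 1 / 2 by norm_num, log_one_half]
  ring

/-- The value of `potential` that determines the bound `X` lies below `potential 0.7`. -/
theorem critical_lt_potential : -2 + 2 * Real.log 2 < potential 0.7 := by
  -- The claim is `-3 log 0.3 - 2 log 2 > 2.2`; exponentiated and raised to the fifth power it reads
  -- `e ^ 11 < (250 / 27) ^ 5`.
  have h1 : (11 : ℝ) / 5 < Real.log (250 / 27) := by
    rw [Real.lt_log_iff_exp_lt (by norm_num)]
    refine lt_of_pow_lt_pow_left₀ 5 (by norm_num) ?_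
    rw [← Real.exp_nat_mul, show ((5 : ℕ) : ℝ) * (11 / 5) = (11 : ℕ) * 1 by norm_num,
      Real.exp_nat_mul]
    calc Real.exp 1 ^ 11 ≤ 2.7182818286 ^ 11 :=
          pow_le_pow_left₀ (Real.exp_pos _).le Real.exp_one_lt_d9.le _
      _ < (250 / 27) ^ 5 := by norm_num
  have h2 : Real.log (250 / 27) = -3 * Real.log (3 / 10) - 2 * Real.log 2 := by
    rw [show (250 : ℝ) / 27 = ((3 / 10) ^ 3 * 2 ^ 2)⁻¹ by norm_num, Real.log_inv,
      Real.log_mul (by norm_num) (by norm_num), Real.log_pow, Real.log_pow]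
    push_cast
    ring
  unfold potential
  rw [show (1 : ℝ) - 0.7 = 3 / 10 by norm_num]
  norm_num
  linarith

theorem exists_potential_eq_critical :
    ∃ X : ℝ, 1 / 2 ≤ X ∧ X < 0.7 ∧ potential X = -2 + 2 * Real.log 2 := by
  have hc : ContinuousOn potential (Icc (1 / 2) 0.7) :=
    continuousOn_potential.mono fun x hx => lt_of_le_of_lt hx.2 (by norm_num)
  have hl := Real.log_two_lt_d9
  obtain ⟨X, hX, h⟩ := intermediate_value_Ico (by norm_num) hc
    (show -2 + 2 * Real.log 2 ∈ Ico (potential (1 / 2)) (potential 0.7) from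
      ⟨by rw [potential_one_half]; linarith, critical_lt_potential⟩)
  exact ⟨X, hX.1, hX.2, h⟩

theorem strictMonoOn_mul_exp : StrictMonoOn (fun w : ℝ => w * Real.exp w) (Ici (-1)) := by
  refine strictMonoOn_of_deriv_pos (convex_Ici _) (by fun_prop) fun w hw => ?_
  rw [interior_Ici] at hw
  have h : HasDerivAt (fun w : ℝ => w * Real.exp w) (1 * Real.exp w + w * Real.exp w) w :=
    (hasDerivAt_id w).mul (Real.hasDerivAt_exp w)
  rw [h.deriv, ← add_mul]
  exact mul_pos (by linarith [mem_Ioi.1 hw]) (Real.exp_pos w)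

theorem lambertW_mul_exp {s : ℝ} (hs : -1 ≤ s) : lambertW (s * Real.exp s) = s :=
  strictMonoOn_mul_exp.injOn.leftInvOn_invFunOn hs

/-- Exponentiating the equation for `X` puts it in the form `u * exp u = const` with `u = 2X - 2`;
since `X ≥ 1/2`, `u ≥ -1` lies on the principal branch. -/
theorem two_mul_eq_add_lambertW {X : ℝ} (h1 : 1 / 2 ≤ X) (h2 : X < 1)
    (hX : potential X = -2 + 2 * Real.log 2) :
    2 * X = 2 + lambertW (-2 * Real.exp (-4 / 3 - 2 / 3 * Real.log 2)) := by
  have hlog : Real.log (1 - X) = -2 * X + 2 / 3 - 2 / 3 * Real.log 2 := by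
    unfold potential at hX
    linarith
  have hexp : 1 - X = Real.exp (-2 * X + 2 / 3 - 2 / 3 * Real.log 2) := by
    rw [← hlog, Real.exp_log (by linarith)]
  have harg : -2 * Real.exp (-4 / 3 - 2 / 3 * Real.log 2) =
      (2 * X - 2) * Real.exp (2 * X - 2) := by
    rw [show 2 * X - 2 = -2 * (1 - X) by ring, hexp, mul_assoc, ← Real.exp_add, ← hexp]
    congr 2
    ring
  rw [harg, lambertW_mul_exp (by linarith)]
  ring

theorem lambert_argument_eq : -2 * Real.exp (-4 / 3 - 2 / 3 * Real.log 2) =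
    -(2 : ℝ) ^ (1 / 3 : ℝ) * Real.exp (-4 / 3) := by
  have h : (2 : ℝ) ^ (1 / 3 : ℝ) = 2 * Real.exp (-(2 / 3 * Real.log 2)) := by
    nth_rw 2 [← Real.exp_log (two_pos (α := ℝ))]
    rw [Real.rpow_def_of_pos two_pos, ← Real.exp_add]
    ring_nf
  rw [h, sub_eq_add_neg, Real.exp_add]
  ring

/-! ### Trajectories emanating from the origin -/

/-- A solution of the relativistic system on `(-∞, T)` with `y ≥ 0` that emanates from `(0, 0)`. -/
structure IsEmanating (T : ℝ) (x y : ℝ → ℝ) : Prop where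
  lt_one : ∀ t < T, x t < 1
  nonneg : ∀ t < T, 0 ≤ y t
  deriv_x : ∀ t < T, HasDerivAt x (y t - x t) t
  deriv_y : ∀ t < T, HasDerivAt y (relA (x t) * y t - relB (x t) * y t ^ 2) t
  tendsto_x : Tendsto x atBot (𝓝 0)
  tendsto_y : Tendsto y atBot (𝓝 0)

theorem rel_field_eq {x y : ℝ} (hx : x < 1) :
    relA x * y - relB x * y ^ 2 = (2 - 3 * x - y) / (1 - x) * y := by
  have : 1 - x ≠ 0 := by linarith
  unfold relA relB
  field_simp

/-- A function on `(-∞, T)` tending to `0` at `-∞` with `f' + f ≤ 0` is nonpositive. -/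
theorem nonpos_of_deriv_add_nonpos {T : ℝ} {f f' : ℝ → ℝ}
    (hf : ∀ t < T, HasDerivAt f (f' t) t) (hle : ∀ t < T, f' t + f t ≤ 0)
    (hlim : Tendsto f atBot (𝓝 0)) {t : ℝ} (ht : t < T) : f t ≤ 0 := by
  -- With the integrating factor `exp s`, the product is antitone and still vanishes at `-∞`.
  have hd : ∀ s < T, HasDerivAt (fun s => f s * Real.exp s)
      (f' s * Real.exp s + f s * Real.exp s) s :=
    fun s hs => (hf s hs).mul (Real.hasDerivAt_exp s)
  have hanti : AntitoneOn (fun s => f s * Real.exp s) (Iio T) := by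
    refine antitoneOn_of_deriv_nonpos (convex_Iio T)
      (fun s hs => (hd s hs).continuousAt.continuousWithinAt) ?_ ?_ <;> rw [interior_Iio]
    · exact fun s hs => (hd s hs).differentiableAt.differentiableWithinAt
    · intro s hs
      rw [(hd s hs).deriv, ← add_mul]
      exact mul_nonpos_of_nonpos_of_nonneg (hle s hs) (Real.exp_pos s).le
  have h0 : Tendsto (fun s => f s * Real.exp s) atBot (𝓝 0) := by
    simpa using hlim.mul Real.tendsto_exp_atBot
  have h1 : f t * Real.exp t ≤ 0 := by
    refine ge_of_tendsto h0 ?_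
    filter_upwards [eventually_le_atBot t] with s hs
    exact hanti (hs.trans_lt ht) ht hs
  exact nonpos_of_mul_nonpos_left h1 (Real.exp_pos t)

/-- The last time before `t` at which a function vanishing at `-∞` takes the value `c`. -/
theorem exists_last_crossing {T c t : ℝ} {f : ℝ → ℝ} (hf : ContinuousOn f (Iio T))
    (hlim : Tendsto f atBot (𝓝 0)) (hc : 0 < c) (ht : t < T) (hct : c < f t) :
    ∃ s < t, f s = c ∧ ∀ r ∈ Ioc s t, c < f r := by
  obtain ⟨t₁, h₁, h₁t⟩ := ((hlim.eventually_lt_const hc).and (eventually_lt_atBot t)).exists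
  have hcont : ContinuousOn f (Icc t₁ t) := hf.mono fun r hr => hr.2.trans_lt ht
  have hcomp : IsCompact (Icc t₁ t ∩ f ⁻¹' Iic c) :=
    isCompact_Icc.of_isClosed_subset (hcont.preimage_isClosed_of_isClosed isClosed_Icc isClosed_Iic)
      inter_subset_left
  obtain ⟨s, ⟨hs, hsc⟩, hmax⟩ := hcomp.exists_isGreatest ⟨t₁, ⟨le_rfl, h₁t.le⟩, h₁.le⟩
  have hsc' : f s ≤ c := hsc
  have hst : s < t := lt_of_le_of_ne hs.2 fun h => by
    rw [h] at hsc'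
    linarith
  have hgt : ∀ r ∈ Ioc s t, c < f r := fun r hr => by
    by_contra! h
    exact absurd (hmax ⟨⟨hs.1.trans hr.1.le, hr.2⟩, h⟩) (not_le.2 hr.1)
  refine ⟨s, hst, le_antisymm hsc' ?_, hgt⟩
  have hlim' : Tendsto f (𝓝[>] s) (𝓝 (f s)) :=
    ((hf s (hst.trans ht)).continuousAt (Iio_mem_nhds (hst.trans ht))).mono_left nhdsWithin_le_nhds
  refine ge_of_tendsto hlim' ?_
  filter_upwards [Ioc_mem_nhdsGT hst] with r hr using (hgt r hr).le

/-- A nonnegative solution of `y' = k y` that starts positive stays positive. -/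
theorem pos_of_linear_ode {s t : ℝ} {y k : ℝ → ℝ} (hst : s ≤ t)
    (hk : ContinuousOn k (Icc s t)) (hy : ∀ r ∈ Icc s t, HasDerivAt y (k r * y r) r)
    (hnonneg : ∀ r ∈ Icc s t, 0 ≤ y r) (hs : 0 < y s) : 0 < y t := by
  -- A constant lower bound `C ≤ k` suffices: as `y ≥ 0`, `y * exp (-C r)` is monotone.
  obtain ⟨C, hC⟩ := (isCompact_Icc.image_of_continuousOn hk).bddBelow
  have hd : ∀ r ∈ Icc s t, HasDerivAt (fun r => y r * Real.exp (-C * r))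
      (k r * y r * Real.exp (-C * r) + y r * (Real.exp (-C * r) * -C)) r := fun r hr => by
    have h := ((hasDerivAt_id r).const_mul (-C)).exp
    simp only [id_eq, mul_one] at h
    exact (hy r hr).mul h
  have hmono : MonotoneOn (fun r => y r * Real.exp (-C * r)) (Icc s t) := by
    refine monotoneOn_of_deriv_nonneg (convex_Icc s t)
      (fun r hr => (hd r hr).continuousAt.continuousWithinAt)
      (fun r hr => (hd r (interior_subset hr)).differentiableAt.differentiableWithinAt)
      fun r hr => ?_
    have hr' := interior_subset hr
    rw [(hd r hr').deriv, show k r * y r * Real.exp (-C * r) + y r * (Real.exp (-C * r) * -C) =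
      (k r - C) * y r * Real.exp (-C * r) by ring]
    exact mul_nonneg (mul_nonneg (sub_nonneg.2 (hC (mem_image_of_mem k hr'))) (hnonneg r hr'))
      (Real.exp_pos _).le
  have h := hmono ⟨le_rfl, hst⟩ ⟨hst, le_rfl⟩ hst
  exact pos_of_mul_pos_left ((mul_pos hs (Real.exp_pos _)).trans_le h) (Real.exp_pos _).le

/-- The left side is convex with minimum at `1/2`, so it is largest at `y = 1`. Concretely, `log y⁻¹
≤ y⁻¹ - 1` and `y⁻¹ ≤ 3 - 2y`, the latter being `(2y - 1)(y - 1) ≤ 0`. -/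
theorem sub_log_le_two {y : ℝ} (h1 : 1 / 2 ≤ y) (h2 : y ≤ 1) : 2 * y - Real.log y ≤ 2 := by
  have h := Real.log_le_sub_one_of_pos (x := y⁻¹) (by positivity)
  rw [Real.log_inv] at h
  have h3 : y⁻¹ ≤ 3 - 2 * y := by
    rw [inv_eq_one_div, div_le_iff₀ (by linarith)]
    nlinarith
  linarith

theorem one_add_log_two_le {y : ℝ} (hy : 0 < y) : 1 + Real.log 2 ≤ 2 * y - Real.log y := by
  have h := Real.log_le_sub_one_of_pos (x := 2 * y) (by positivity)
  rw [Real.log_mul two_ne_zero hy.ne'] at h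
  linarith

namespace IsEmanating

variable {T t : ℝ} {x y : ℝ → ℝ}

theorem continuousOn_x (h : IsEmanating T x y) : ContinuousOn x (Iio T) :=
  fun t ht => (h.deriv_x t ht).continuousAt.continuousWithinAt

theorem continuousOn_y (h : IsEmanating T x y) : ContinuousOn y (Iio T) :=
  fun t ht => (h.deriv_y t ht).continuousAt.continuousWithinAt

theorem x_nonneg (h : IsEmanating T x y) (ht : t < T) : 0 ≤ x t := by
  have := nonpos_of_deriv_add_nonpos (f := fun t => -x t) (f' := fun t => -(y t - x t))
    (fun s hs => (h.deriv_x s hs).neg) (fun s hs => by linarith [h.nonneg s hs])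
    (by simpa using h.tendsto_x.neg) ht
  linarith

/-- The trajectory stays below the unstable direction at the origin. -/
theorem y_le_three_mul (h : IsEmanating T x y) (ht : t < T) : y t ≤ 3 * x t := by
  have := nonpos_of_deriv_add_nonpos (f := fun t => y t - 3 * x t)
    (f' := fun t => relA (x t) * y t - relB (x t) * y t ^ 2 - 3 * (y t - x t))
    (fun s hs => (h.deriv_y s hs).sub ((h.deriv_x s hs).const_mul 3))
    (fun s hs => ?_) (by simpa using h.tendsto_y.sub (h.tendsto_x.const_mul 3)) ht
  · linarith
  · have h1 : 0 < 1 - x s := by linarith [h.lt_one s hs]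
    -- The slope `3 = a(0) + 1` is that of the eigenvector for the eigenvalue `2`, so the linear
    -- terms cancel and a quadratic remainder of fixed sign is left.
    have h2 : relA (x s) * y s - relB (x s) * y s ^ 2 - 3 * (y s - x s) + (y s - 3 * x s) =
        -((x s * y s + y s ^ 2) / (1 - x s)) := by
      unfold relA relB
      field_simp
      ring
    have h3 := h.x_nonneg hs
    have h4 := h.nonneg s hs
    rw [h2]
    exact neg_nonpos.2 (by positivity)

/-- The line `y = 3x` meets the isocline `2 - 3x - y = 0` at `(1/3, 1)`, which is the role of `w`.
Where `y > 1`, `3x ≥ y` forces `2 - 3x - y < 0`, so `y` cannot rise above `1`. -/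
theorem y_le_one (h : IsEmanating T x y) (ht : t < T) : y t ≤ 1 := by
  by_contra! hlt
  obtain ⟨s, hst, hs, hgt⟩ := exists_last_crossing h.continuousOn_y h.tendsto_y one_pos ht hlt
  have hanti : AntitoneOn y (Icc s t) := by
    refine antitoneOn_of_deriv_nonpos (convex_Icc s t)
      (h.continuousOn_y.mono fun r hr => hr.2.trans_lt ht) ?_ ?_ <;> rw [interior_Icc]
    · exact fun r hr => (h.deriv_y r (hr.2.trans ht)).differentiableAt.differentiableWithinAt
    · intro r hr
      have hrT := hr.2.trans ht
      have h1 := hgt r ⟨hr.1, hr.2.le⟩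
      have h2 := h.y_le_three_mul hrT
      have h3 := h.lt_one r hrT
      rw [(h.deriv_y r hrT).deriv, rel_field_eq h3]
      exact mul_nonpos_of_nonpos_of_nonneg
        (div_nonpos_of_nonpos_of_nonneg (by linarith) (by linarith)) (by linarith)
  have := hanti ⟨le_rfl, hst.le⟩ ⟨hst.le, le_rfl⟩ hst.le
  linarith

/-- The Lyapunov function does not increase as long as `y` stays positive. -/
theorem lyapunov_le (h : IsEmanating T x y) {s : ℝ} (hst : s ≤ t) (ht : t < T)
    (hpos : ∀ r ∈ Icc s t, 0 < y r) :
    2 * y t - Real.log (y t) + potential (x t) ≤ 2 * y s - Real.log (y s) + potential (x s) := by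
  have hT : ∀ r ∈ Icc s t, r < T := fun r hr => hr.2.trans_lt ht
  have hd : ∀ r ∈ Icc s t, HasDerivAt (fun r => 2 * y r - Real.log (y r) + potential (x r))
      (2 * (relA (x r) * y r - relB (x r) * y r ^ 2) -
        (relA (x r) * y r - relB (x r) * y r ^ 2) / y r +
        (-6 + 3 / (1 - x r)) * (y r - x r)) r := fun r hr =>
    (((h.deriv_y r (hT r hr)).const_mul 2).sub
      ((h.deriv_y r (hT r hr)).log (hpos r hr).ne')).add
      ((hasDerivAt_potential (h.lt_one r (hT r hr))).comp r (h.deriv_x r (hT r hr)))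
  have hanti : AntitoneOn (fun r => 2 * y r - Real.log (y r) + potential (x r)) (Icc s t) := by
    refine antitoneOn_of_deriv_nonpos (convex_Icc s t)
      (fun r hr => (hd r hr).continuousAt.continuousWithinAt)
      (fun r hr => (hd r (interior_subset hr)).differentiableAt.differentiableWithinAt)
      fun r hr => ?_
    have hr' := interior_subset hr
    have h1 : 0 < 1 - x r := by linarith [h.lt_one r (hT r hr')]
    have h2 := (hpos r hr').ne'
    -- Over the denominator `1 - x`, the mixed terms in `x` and `y` cancel and two squares centred
    -- at the stationary point remain.
    have h3 : 2 * (relA (x r) * y r - relB (x r) * y r ^ 2) -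
        (relA (x r) * y r - relB (x r) * y r ^ 2) / y r + (-6 + 3 / (1 - x r)) * (y r - x r) =
        -((2 * (y r - 1 / 2) ^ 2 + 6 * (x r - 1 / 2) ^ 2) / (1 - x r)) := by
      unfold relA relB
      field_simp
      ring
    rw [(hd r hr').deriv, h3]
    exact neg_nonpos.2 (by positivity)
  exact hanti ⟨le_rfl, hst⟩ ⟨hst, le_rfl⟩ hst

theorem x_le (h : IsEmanating T x y) {X : ℝ} (h1 : 1 / 2 ≤ X) (h2 : X < 1)
    (hX : potential X = -2 + 2 * Real.log 2) (ht : t < T) : x t ≤ X := by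
  rcases le_or_gt (x t) (1 / 2) with hle | hgt
  · exact hle.trans h1
  obtain ⟨s, hst, hs, hsgt⟩ :=
    exists_last_crossing h.continuousOn_x h.tendsto_x one_half_pos ht hgt
  have hT : ∀ r ∈ Icc s t, r < T := fun r hr => hr.2.trans_lt ht
  -- `x` exceeds `1/2 = x s` just after `s`, so its right slopes there are nonnegative and `y s - x
  -- s ≥ 0`.
  have hys : 1 / 2 ≤ y s := by
    have hslope := (hasDerivAt_iff_tendsto_slope.1 (h.deriv_x s (hst.trans ht))).mono_left
      (nhdsWithin_mono s (fun r (hr : r ∈ Ioi s) => hr.ne'))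
    have h0 : 0 ≤ y s - x s := by
      refine ge_of_tendsto hslope ?_
      filter_upwards [Ioc_mem_nhdsGT hst] with r hr
      rw [slope_def_field]
      exact div_nonneg (by linarith [hsgt r hr]) (by linarith [hr.1])
    linarith
  have hpos : ∀ r ∈ Icc s t, 0 < y r := fun r hr => by
    have hT' : ∀ q ∈ Icc s r, q < T := fun q hq => hT q ⟨hq.1, hq.2.trans hr.2⟩
    refine pos_of_linear_ode (s := s) (k := fun q => (2 - 3 * x q - y q) / (1 - x q)) hr.1 ?_
      (fun q hq => ?_) (fun q hq => h.nonneg q (hT' q hq)) (by linarith)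
    · have hx := h.continuousOn_x.mono hT'
      have hy := h.continuousOn_y.mono hT'
      exact ContinuousOn.div (by fun_prop) (by fun_prop) fun q hq => by
        linarith [h.lt_one q (hT' q hq)]
    · rw [← rel_field_eq (h.lt_one q (hT' q hq))]
      exact h.deriv_y q (hT' q hq)
  have hL := h.lyapunov_le hst.le ht hpos
  rw [hs, potential_one_half] at hL
  have h3 := sub_log_le_two hys (h.y_le_one (hst.trans ht))
  have h4 := one_add_log_two_le (hpos t ⟨hst.le, le_rfl⟩)
  exact (strictMonoOn_potential.le_iff_le ⟨hgt.le, h.lt_one t ht⟩ ⟨h1, h2⟩).1 (by linarith)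

end IsEmanating

/-- The second equation is linear in `y` once `x` and `y` are frozen in the coefficient `k`, so `y *
exp (-∫ k)` is constant; it is positive at late times because `y → 1/2`. -/
theorem IsHeteroclinic.y_pos {x y : ℝ → ℝ}
    (h : IsHeteroclinic relA relB (Iio 1) (1 / 2) x y) (t : ℝ) : 0 < y t := by
  have hx : Continuous x := continuous_iff_continuousAt.2 fun t => (h.deriv_x t).continuousAt
  have hy : Continuous y := continuous_iff_continuousAt.2 fun t => (h.deriv_y t).continuousAt
  set k : ℝ → ℝ := fun q => (2 - 3 * x q - y q) / (1 - x q) with hkdef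
  have hk : Continuous k :=
    Continuous.div (by fun_prop) (by fun_prop) fun q => by linarith [mem_Iio.1 (h.mem_domain q)]
  have hd : ∀ s, HasDerivAt (fun s => y s * Real.exp (-∫ q in (0 : ℝ)..s, k q)) 0 s := fun s => by
    have h1 := (hk.integral_hasStrictDerivAt 0 s).hasDerivAt.neg.exp
    refine ((h.deriv_y s).mul h1).congr_deriv ?_
    rw [rel_field_eq (h.mem_domain s)]
    simp only [hkdef, Pi.neg_apply]
    ring
  have hlim : Tendsto y atTop (𝓝 (1 / 2)) := (continuous_snd.tendsto _).comp h.tendsto_atTop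
  obtain ⟨s, hs⟩ := (hlim.eventually_const_lt one_half_pos).exists
  have hconst := is_const_of_deriv_eq_zero (fun s => (hd s).differentiableAt)
    (fun s => (hd s).deriv) s t
  have hprod := mul_pos hs (Real.exp_pos (-∫ q in (0 : ℝ)..s, k q))
  exact pos_of_mul_pos_left (hprod.trans_eq hconst) (Real.exp_pos _).le

theorem IsHeteroclinic.isEmanating {x y : ℝ → ℝ}
    (h : IsHeteroclinic relA relB (Iio 1) (1 / 2) x y) (T : ℝ) : IsEmanating T x y where
  lt_one t _ := h.mem_domain t
  nonneg t _ := (h.y_pos t).le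
  deriv_x t _ := h.deriv_x t
  deriv_y t _ := h.deriv_y t
  tendsto_x := (continuous_fst.tendsto _).comp h.tendsto_atBot
  tendsto_y := (continuous_snd.tendsto _).comp h.tendsto_atBot

/-! ### The Tolman–Oppenheimer–Volkoff equation -/

namespace IsTOVSolution

variable {G c R : ℝ} {ϱ p : ℝ → ℝ}

/-- The mass coincides on `[0, R]` with a primitive of a globally continuous function. -/
theorem exists_massExtension (h : IsTOVSolution G c R ϱ p) (hR : 0 < R) :
    ∃ m g : ℝ → ℝ, (∀ r, HasDerivAt m (g r) r) ∧ m 0 = 0 ∧ g 0 = 0 ∧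
      (∀ r ∈ Icc 0 R, mass ϱ r = m r) ∧ ∀ r ∈ Ioc 0 R, g r = 4 * Real.pi * (r ^ 2 * ϱ r) := by
  -- The value at `0` is `0` anyway; writing it as an update turns the condition at the centre into
  -- continuity at `0`. Extending `f` by constants beyond `[0, R]` then makes the primitive
  -- differentiable at both endpoints.
  set f : ℝ → ℝ := Function.update (fun s => s ^ 2 * ϱ s) 0 0 with hf
  have hfeq : ∀ s ∈ Ioc 0 R, f s = s ^ 2 * ϱ s := fun s hs => by
    simp [hf, Function.update_of_ne hs.1.ne']
  have hcont : ContinuousOn f (Icc 0 R) := by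
    intro s hs
    rcases hs.1.eq_or_lt with rfl | hpos
    · refine continuousWithinAt_update_same.2 (h.centre.mono_left (nhdsWithin_mono _ ?_))
      rintro r ⟨hr, hr0⟩
      exact lt_of_le_of_ne hr.1 (Ne.symm hr0)
    · have h1 : ContinuousWithinAt (fun s => s ^ 2 * ϱ s) (Ioc 0 R) s :=
        ContinuousWithinAt.mul (by fun_prop) (h.continuousOn s ⟨hpos, hs.2⟩)
      have h2 : ContinuousWithinAt f (Ioc 0 R) s := h1.congr hfeq (hfeq s ⟨hpos, hs.2⟩)
      refine h2.mono_of_mem_nhdsWithin ?_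
      filter_upwards [self_mem_nhdsWithin, mem_nhdsWithin_of_mem_nhds (Ioi_mem_nhds hpos)]
        with r hr hr0 using ⟨hr0, hr.2⟩
  have hg : Continuous (IccExtend hR.le (domRestrict (Icc 0 R) f)) :=
    (continuousOn_iff_continuous_domRestrict.1 hcont).Icc_extend'
  set g := IccExtend hR.le (domRestrict (Icc 0 R) f) with hgdef
  have hgeq : ∀ s ∈ Icc 0 R, g s = f s := fun s hs => by
    rw [hgdef, IccExtend_of_mem _ _ hs, domRestrict_apply]
  refine ⟨fun r => 4 * Real.pi * ∫ s in (0 : ℝ)..r, g s, fun r => 4 * Real.pi * g r,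
    fun r => (hg.integral_hasStrictDerivAt 0 r).hasDerivAt.const_mul _, by simp, ?_,
    fun r hr => ?_, fun r hr => ?_⟩
  · simp [hgeq 0 ⟨le_rfl, hR.le⟩, hf]
  · unfold mass
    congr 1
    refine intervalIntegral.integral_congr_ae (Eventually.of_forall fun s hs => ?_)
    rw [uIoc_of_le hr.1] at hs
    have hs' : s ∈ Ioc 0 R := ⟨hs.1, hs.2.trans hr.2⟩
    rw [hgeq s (Ioc_subset_Icc_self hs'), hfeq s hs']
  · simp only
    rw [hgeq r (Ioc_subset_Icc_self hr), hfeq r hr]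

theorem hasDerivAt_mass (h : IsTOVSolution G c R ϱ p) {r : ℝ} (hr : r ∈ Ioo 0 R) :
    HasDerivAt (mass ϱ) (4 * Real.pi * (r ^ 2 * ϱ r)) r := by
  obtain ⟨m, g, hm, -, -, hmass, hg⟩ := h.exists_massExtension (hr.1.trans hr.2)
  rw [← hg r ⟨hr.1, hr.2.le⟩]
  refine (hm r).congr_of_eventuallyEq ?_
  filter_upwards [Icc_mem_nhds hr.1 hr.2] with s hs using hmass s hs

/-- The quotient is the slope at `0` of a primitive whose integrand vanishes there. -/
theorem tendsto_mass_div (h : IsTOVSolution G c R ϱ p) (hR : 0 < R) :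
    Tendsto (fun r => mass ϱ r / r) (𝓝[>] 0) (𝓝 0) := by
  obtain ⟨m, g, hm, hm0, hg0, hmass, -⟩ := h.exists_massExtension hR
  have hslope := (hasDerivAt_iff_tendsto_slope.1 (hm 0)).mono_left
    (nhdsWithin_mono 0 (fun r (hr : r ∈ Ioi 0) => hr.ne'))
  rw [hg0] at hslope
  refine hslope.congr' ?_
  filter_upwards [Ioc_mem_nhdsGT hR] with r hr
  rw [slope_def_field, hm0, sub_zero, sub_zero, hmass r (Ioc_subset_Icc_self hr)]

theorem tendsto_mass_left (h : IsTOVSolution G c R ϱ p) (hR : 0 < R) :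
    Tendsto (mass ϱ) (𝓝[<] R) (𝓝 (mass ϱ R)) := by
  obtain ⟨m, g, hm, -, -, hmass, -⟩ := h.exists_massExtension hR
  rw [hmass R ⟨hR.le, le_rfl⟩]
  refine ((hm R).continuousAt.tendsto.mono_left nhdsWithin_le_nhds).congr' ?_
  filter_upwards [Ico_mem_nhdsLT hR] with r hr using (hmass r ⟨hr.1, hr.2.le⟩).symm

theorem hasDerivAt_density (h : IsTOVSolution G c R ϱ p) (hc : 0 < c) {r : ℝ}
    (hr : r ∈ Ioo 0 R) :
    HasDerivAt ϱ (-(2 * G * ϱ r * (mass ϱ r + 4 * Real.pi * r ^ 3 * ϱ r)) /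
      (r * (r * c ^ 2 - 2 * G * mass ϱ r))) r := by
  have h1 : HasDerivAt (fun s => p s / c ^ 2) _ r := (h.tov r hr).div_const (c ^ 2)
  have h2 : HasDerivAt ϱ _ r := h1.congr_of_eventuallyEq (by
    filter_upwards [Ioo_mem_nhds hr.1 hr.2] with s hs
    rw [h.state s ⟨hs.1, hs.2.le⟩]
    field_simp)
  refine h2.congr_deriv ?_
  rw [h.state r ⟨hr.1, hr.2.le⟩]
  have h3 : r * c ^ 2 - 2 * G * mass ϱ r ≠ 0 := by linarith [h.no_horizon r hr]
  have h4 := hr.1.ne'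
  field_simp
  ring

/-- In the logarithmic radius, a static configuration is a trajectory emanating from the origin. -/
theorem isEmanating (h : IsTOVSolution G c R ϱ p) (hG : 0 < G) (hc : 0 < c) (hR : 0 < R) :
    IsEmanating (Real.log R) (fun t => 2 * G / c ^ 2 * (mass ϱ (Real.exp t) / Real.exp t))
      (fun t => 8 * Real.pi * G / c ^ 2 * (Real.exp t ^ 2 * ϱ (Real.exp t))) := by
  have hmem : ∀ t < Real.log R, Real.exp t ∈ Ioo 0 R := fun t ht =>
    ⟨Real.exp_pos t, (Real.lt_log_iff_exp_lt hR).1 ht⟩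
  have hexp : Tendsto Real.exp atBot (𝓝[>] 0) := Real.tendsto_exp_atBot_nhdsGT
  refine ⟨fun t ht => ?_, fun t ht => ?_, fun t ht => ?_, fun t ht => ?_, ?_, ?_⟩
  · have h1 := h.no_horizon _ (hmem t ht)
    have h2 := Real.exp_pos t
    rw [div_mul_div_comm, div_lt_one (by positivity)]
    linarith
  · have h1 := h.density_nonneg _ (Ioo_subset_Ioc_self (hmem t ht))
    have := Real.pi_pos
    positivity
  · have h1 := (h.hasDerivAt_mass (hmem t ht)).comp t (Real.hasDerivAt_exp t)
    have h2 := (h1.div (Real.hasDerivAt_exp t) (Real.exp_pos t).ne').const_mul (2 * G / c ^ 2)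
    refine h2.congr_deriv ?_
    have h3 := (Real.exp_pos t).ne'
    simp only [Function.comp_apply]
    field_simp
    ring
  · have h1 := (h.hasDerivAt_density hc (hmem t ht)).comp t (Real.hasDerivAt_exp t)
    have h2 := (((Real.hasDerivAt_exp t).pow 2).mul h1).const_mul (8 * Real.pi * G / c ^ 2)
    refine h2.congr_deriv ?_
    have h3 := (Real.exp_pos t).ne'
    have h4 : Real.exp t * c ^ 2 - 2 * G * mass ϱ (Real.exp t) ≠ 0 := by
      linarith [h.no_horizon _ (hmem t ht)]
    have h5 : 1 - 2 * G / c ^ 2 * (mass ϱ (Real.exp t) / Real.exp t) =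
        (Real.exp t * c ^ 2 - 2 * G * mass ϱ (Real.exp t)) / (Real.exp t * c ^ 2) := by
      field_simp
    simp only [Function.comp_apply, Pi.pow_apply, relA, relB, h5]
    -- What remains is a rational identity; naming the denominator `D` lets `field_simp` clear it as
    -- an atom.
    generalize mass ϱ (Real.exp t) = m at h4 ⊢
    generalize ϱ (Real.exp t) = d
    generalize Real.exp t = r at h3 h4 ⊢
    generalize hD : r * c ^ 2 - 2 * G * m = D at h4 ⊢
    field_simp
    rw [← hD]
    ring
  · simpa using ((h.tendsto_mass_div hR).comp hexp).const_mul (2 * G / c ^ 2)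
  · simpa using (h.centre.comp hexp).const_mul (8 * Real.pi * G / c ^ 2)

theorem mass_radius_le (h : IsTOVSolution G c R ϱ p) (hG : 0 < G) (hc : 0 < c) (hR : 0 < R)
    {X : ℝ} (h1 : 1 / 2 ≤ X) (h2 : X < 1) (hX : potential X = -2 + 2 * Real.log 2) :
    2 * G * mass ϱ R / (R * c ^ 2) ≤ X := by
  have hid : Tendsto (fun r : ℝ => r * c ^ 2) (𝓝[<] R) (𝓝 (R * c ^ 2)) :=
    (tendsto_id.mul_const _).mono_left nhdsWithin_le_nhds
  -- The trajectory only covers `r < R`, so the bound passes to the surface as a left limit.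
  refine le_of_tendsto (((h.tendsto_mass_left hR).const_mul (2 * G)).div hid (by positivity)) ?_
  filter_upwards [Ioo_mem_nhdsLT hR] with r hr
  have := (h.isEmanating hG hc hR).x_le h1 h2 hX (Real.log_lt_log hr.1 hr.2)
  simp only [Real.exp_log hr.1] at this
  rwa [div_mul_div_comm, mul_comm (c ^ 2)] at this

end IsTOVSolution

end TOV

theorem corollary1 :
    -- the stationary point `z = 1/2` and the intersection point `w = 1/3`
    ∃ z w X : ℝ, z = 1 / 2 ∧ TOV.relA z = z * TOV.relB z ∧
      (0 < w ∧ w < 1 ∧ (TOV.relA 0 + 1) * w * TOV.relB w = TOV.relA w) ∧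
      -- the explicit form of `H`
      (∀ x, z ≤ x → x < 1 → 2 * TOV.lyapH TOV.relA TOV.relB z x =
        -6 * x - 3 * Real.log (1 - x) + 6 * z + 3 * Real.log (1 - z)) ∧
      -- `X` is the only solution in `[z, 1)` of the equation that defines it
      (∀ x, z ≤ x → x < 1 → (2 * TOV.lyapH TOV.relA TOV.relB z x =
        Real.log z - 2 * z + 2 * (TOV.relA 0 + 1) * w - Real.log ((TOV.relA 0 + 1) * w) ↔
          x = X)) ∧
      z ≤ X ∧ X < 1 ∧
      2 * X = 2 + TOV.lambertW (-2 * Real.exp (-4 / 3 - 2 / 3 * Real.log 2)) ∧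
      2 * X = 2 + TOV.lambertW (-(2 : ℝ) ^ (1 / 3 : ℝ) * Real.exp (-4 / 3)) ∧
      X < 0.7 ∧
      -- the bound for the heteroclinic trajectory
      (∀ x y : ℝ → ℝ, TOV.IsHeteroclinic TOV.relA TOV.relB (Set.Iio 1) z x y →
        ∀ t, x t ≤ X) ∧
      -- the mass-radius bound
      (∀ G c R : ℝ, 0 < G → 0 < c → 0 < R → ∀ ϱ p : ℝ → ℝ, TOV.IsTOVSolution G c R ϱ p →
        2 * G * TOV.mass ϱ R / (R * c ^ 2) < 0.7) := by
  obtain ⟨X, h1, h2, hX⟩ := TOV.exists_potential_eq_critical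
  have hX1 : X < 1 := h2.trans (by norm_num)
  have hW := TOV.two_mul_eq_add_lambertW h1 hX1 hX
  refine ⟨1 / 2, 1 / 3, X, rfl, by norm_num [TOV.relA, TOV.relB],
    ⟨by norm_num, by norm_num, by norm_num [TOV.relA, TOV.relB]⟩, fun x _ hx => ?_,
    fun x hzx hx => ?_, h1, hX1, hW, ?_, h2,
    fun x y h t => (h.isEmanating (t + 1)).x_le h1 hX1 hX (lt_add_one t),
    fun G c R hG hc hR ϱ p h => (h.mass_radius_le hG hc hR h1 hX1 hX).trans_lt h2⟩
  · rw [TOV.two_mul_lyapH hx]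
    unfold TOV.potential
    ring
  · have hrhs : Real.log (1 / 2) - 2 * (1 / 2) + 2 * (TOV.relA 0 + 1) * (1 / 3) -
        Real.log ((TOV.relA 0 + 1) * (1 / 3)) = 1 - Real.log 2 := by
      rw [show (TOV.relA 0 + 1) * (1 / 3) = 1 by norm_num [TOV.relA],
        show 2 * (TOV.relA 0 + 1) * (1 / 3) = 2 by norm_num [TOV.relA], Real.log_one,
        TOV.log_one_half]
      ring
    -- Injectivity of `potential` on `[1/2, 1)` replaces `x = X` by equality of potentials, and both
    -- sides become the same linear equation.
    rw [hrhs, TOV.two_mul_lyapH hx, TOV.potential_one_half,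
      ← TOV.strictMonoOn_potential.injOn.eq_iff (Set.mem_Ico.2 ⟨hzx, hx⟩)
        (Set.mem_Ico.2 ⟨h1, hX1⟩), hX]
    constructor <;> intro h <;> linarith
  · rw [hW, TOV.lambert_argument_eq]
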